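/- Let $\mathcal H$ be a real Hilbert space, $T>0$, and let $C\colon[0,T]\rightrightarrows\mathcal H$ be a lower semicontinuous set-valued mapping, i.e. for every $\bar t\in[0,T]$ and every open $U\subset\mathcal H$ with $C(\bar t)\cap U\neq\emptyset$, the set $\{t\in[0,T]: C(t)\cap U\ne\emptyset\}$ is a neighborhood of $\bar t$ in $[0,T]$. For $S\subset\mathcal H$ and $x\in S$, let the proximal normal cone $N^P(S;x)$ be the set of all $\zeta\in\mathcal H$ for which there are $\sigma\ge 0$ and $\eta>0$ with $\langle\zeta,y-x\rangle\le\sigma\|y-x\|^2$ for all $y\in S$ with $\|y-x\|<\eta$. For $\rho\in(0,+\infty]$, a nonempty closed set $S\subset\mathcal H$ is $\rho$-uniformly prox-regular if $\langle\zeta,x'-x\rangle\le\frac{\|\zeta\|}{2\rho}\|x'-x\|^2$ for all $x,x'\in S$ and $\zeta\in N^P(S;x)$ (the right-hand side being $0$ if $\rho=+\infty$). Then each of the following two conditions (i) there are $\rho\in(0,+\infty]$ and $r>0$ such that, for every $t\in[0,T]$, the set $C(t)$ is nonempty, closed, connected, $\rho$-uniformly prox-regular, and contained in the closed ball of radius $r$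 centered at $0$; (ii) for every $t\in[0,T]$, the set $C(t)$ is nonempty, closed and convex; implies the bounded selection-extension property: for every bounded mapping $x\colon[0,T]\to\mathcal H$ with $x(t)\in C(t)$ for all $t\in[0,T]$, and every $\eta>0$, there is a constant $R_{x,\eta}>0$ such that for every compact set $K\subset[0,T]$ and every continuous mapping $y\colon K\to\mathcal H$ with $y(t)\in C(t)$ and $\|y(t)-x(t)\|\le\eta$ for all $t\in K$, there is a continuous mapping $\bar y\colon[0,T]\to\mathcal H$ with $\bar y(t)\in C(t)$ for all $t\in[0,T]$, $\bar y=y$ on $K$, and $\sup_{t\in[0,T]}\|\bar y(t)\|\le R_{x,\eta}$. -/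

import Mathlib

open scoped ENNReal

noncomputable section

namespace MovingSet

variable {H : Type*} [NormedAddCommGroup H] [InnerProductSpace ℝ H]

/-- The proximal subdifferential of an extended-real-valued function `f : H → ℝ ∪ {+∞}` at `x`
(empty outside the domain of `f`). The radius `η` of the ball is positive. -/
def proximalSubdifferential (f : H → WithTop ℝ) (x : H) : Set H :=
  {ζ | f x ≠ ⊤ ∧ ∃ σ : ℝ, 0 ≤ σ ∧ ∃ η : ℝ, 0 < η ∧ ∀ y ∈ Metric.ball x η,
    f x + ((inner ℝ ζ (y - x) - σ * ‖y - x‖ ^ 2 : ℝ) : WithTop ℝ) ≤ f y}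

open Classical in
/-- The indicator function of `S`: `0` on `S` and `+∞` off `S`. -/
def indicatorFun (S : Set H) (x : H) : WithTop ℝ := if x ∈ S then 0 else ⊤

/-- The proximal normal cone of `S` at `x`: the proximal subdifferential of the indicator. -/
def proximalNormalCone (S : Set H) (x : H) : Set H :=
  proximalSubdifferential (indicatorFun S) x

/-- The proximal normal cone written out. -/
theorem mem_proximalNormalCone_iff {S : Set H} {x ζ : H} :
    ζ ∈ proximalNormalCone S x ↔ x ∈ S ∧ ∃ σ : ℝ, 0 ≤ σ ∧ ∃ η : ℝ, 0 < η ∧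
      ∀ y ∈ S, y ∈ Metric.ball x η → inner ℝ ζ (y - x) ≤ σ * ‖y - x‖ ^ 2 := by
  by_cases hx : x ∈ S
  · have key : ∀ (σ η : ℝ) (y : H), (y ∈ Metric.ball x η → indicatorFun S x +
        ((inner ℝ ζ (y - x) - σ * ‖y - x‖ ^ 2 : ℝ) : WithTop ℝ) ≤ indicatorFun S y) ↔
        (y ∈ S → y ∈ Metric.ball x η → inner ℝ ζ (y - x) ≤ σ * ‖y - x‖ ^ 2) := by
      intro σ η y
      by_cases hy : y ∈ S
      · simp only [indicatorFun, hx, hy, if_true, zero_add, true_imp_iff]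
        rw [← WithTop.coe_zero, WithTop.coe_le_coe, sub_nonpos]
      · simp [indicatorFun, hy]
    have hne : indicatorFun S x ≠ ⊤ := by simp [indicatorFun, hx]
    simp only [proximalNormalCone, proximalSubdifferential, Set.mem_ofPred_eq, key, hx, hne,
      ne_eq, not_false_eq_true, true_and]
  · simp [proximalNormalCone, proximalSubdifferential, indicatorFun, hx]

/-- `ρ`-uniform prox-regularity, for `ρ ∈ (0, +∞]`. The factor `((2 * ρ)⁻¹).toReal` is the real
number `1 / (2ρ)`, which is `0` for `ρ = +∞`. -/
def IsUniformlyProxRegular (ρ : ℝ≥0∞) (S : Set H) : Prop :=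
  S.Nonempty ∧ IsClosed S ∧ ∀ x ∈ S, ∀ ζ ∈ proximalNormalCone S x, ∀ x' ∈ S,
    inner ℝ ζ (x' - x) ≤ ‖ζ‖ * ((2 * ρ)⁻¹).toReal * ‖x' - x‖ ^ 2

/-- Every value of `C` is nonempty, closed, connected and `ρ`-uniformly prox-regular (with the
same `ρ` for all times). -/
def ProxRegularValues {T : ℝ} (ρ : ℝ≥0∞) (C : Set.Icc (0 : ℝ) T → Set H) : Prop :=
  ∀ t, (C t).Nonempty ∧ IsClosed (C t) ∧ IsConnected (C t) ∧ IsUniformlyProxRegular ρ (C t)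

/-- The bounded selection-extension property along trajectories. The constant `R` may depend on
`x` and `η`, but not on the compact set `K` or on the partial selection `y`. -/
def BoundedSelectionExtension {T : ℝ} (C : Set.Icc (0 : ℝ) T → Set H) : Prop :=
  ∀ x : Set.Icc (0 : ℝ) T → H, Bornology.IsBounded (Set.range x) → (∀ t, x t ∈ C t) →
    ∀ η : ℝ, 0 < η → ∃ R : ℝ, 0 < R ∧
      ∀ K : Set (Set.Icc (0 : ℝ) T), IsCompact K →
        ∀ y : K → H, Continuous y → (∀ t : K, y t ∈ C t) → (∀ t : K, ‖y t - x t‖ ≤ η) →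
          ∃ ybar : Set.Icc (0 : ℝ) T → H, Continuous ybar ∧ (∀ t, ybar t ∈ C t) ∧
            (∀ t : K, ybar t = y t) ∧ ∀ t, ‖ybar t‖ ≤ R

end MovingSet

end

namespace MovingSet

open Filter Topology Set Metric

/-! ### Continuous selections on an interval under approximate midpoints -/

section Selection

/-! Both conditions reduce to Michael's selection theorem over an interval. Since time is
one-dimensional, the values need not be convex: connectedness gives a first approximate selection,
and a scale `l`, uniform in time, below which points have approximate midpoints lets it be corrected
by geometrically decreasing amounts (`exists_continuous_approx_step`,
`exists_continuous_selection`). Replacing the values on `K` by `{y t}` preserves all hypotheses, so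
selection yields extension.

Uniform prox-regularity gives approximate midpoints by almost projecting a midpoint onto the set
(`IsUniformlyProxRegular.hasApproxMidpoints`); boundedness is then free. For convex values,
midpoints are exact, and the bound comes from truncating `C` by a ball around a fixed continuous
selection. -/

theorem hasOpenCGraph_thickening {X E : Type*} [TopologicalSpace X] [PseudoMetricSpace E]
    {G : X → Set E} (hG : LowerHemicontinuous G) (δ : ℝ) :
    HasOpenCGraph fun t ↦ thickening δ (G t) := by
  rw [HasOpenCGraph, isOpen_iff_mem_nhds]
  rintro ⟨t₀, z₀⟩ hz
  obtain ⟨w, hw, hzw⟩ := mem_thickening_iff.1 hz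
  obtain ⟨e, he, hlt⟩ : ∃ e > 0, dist z₀ w + e + e < δ :=
    ⟨(δ - dist z₀ w) / 3, by linarith, by linarith⟩
  have h1 := lowerHemicontinuousAt_iff.1 (hG t₀) (ball w e) isOpen_ball ⟨w, hw, mem_ball_self he⟩
  have h2 : ∀ᶠ z in 𝓝 z₀, z ∈ ball z₀ e := ball_mem_nhds _ he
  filter_upwards [h1.prod_nhds h2]
  rintro ⟨t, z⟩ ⟨⟨v, hv, hvw⟩, hzz⟩
  refine mem_thickening_iff.2 ⟨v, hv, ?_⟩
  rw [mem_ball] at hvw hzz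
  have := dist_triangle z z₀ v
  have := dist_triangle z₀ w v
  rw [dist_comm w v] at this
  simp only at *
  linarith

theorem hasOpenCGraph_ball {X E : Type*} [TopologicalSpace X] [PseudoMetricSpace E]
    {f : X → E} (hf : Continuous f) (δ : ℝ) : HasOpenCGraph fun t ↦ ball (f t) δ :=
  isOpen_lt (continuous_snd.dist (hf.comp continuous_fst)) continuous_const

variable {E : Type*} [NormedAddCommGroup E] [NormedSpace ℝ E] {a b : ℝ}

/-- By compactness, a path inside `O s` stays inside `O t` for `t` near `s`. It is run through in
that short time; the segment takes up the rest of `[s, s']`. -/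
theorem exists_continuous_bridge {O : Icc a b → Set E} (hO : HasOpenCGraph O) {s s' : Icc a b}
    (hs : s < s') {p q q' : E} (hpq : JoinedIn (O s) p q)
    (hseg : ∀ t ∈ Icc s s', segment ℝ q q' ⊆ O t) :
    ∃ h : Icc a b → E, Continuous h ∧ h s = p ∧ h s' = q' ∧ ∀ t ∈ Icc s s', h t ∈ O t := by
  obtain ⟨γ, hγ⟩ := hpq
  have htube : ∀ᶠ t in 𝓝 s, ∀ u ∈ (univ : Set unitInterval), γ u ∈ O t := by
    refine isCompact_univ.eventually_forall_of_forall_eventually fun u _ ↦ ?_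
    have hc : Continuous fun z : Icc a b × unitInterval ↦ (z.1, γ z.2) := by fun_prop
    exact (hO.preimage hc).mem_nhds (hγ u)
  obtain ⟨e, he, hball⟩ := Metric.eventually_nhds_iff.1 htube
  have hs' : (s : ℝ) < s' := hs
  obtain ⟨τ, hτ, hτe, hτs⟩ : ∃ τ > 0, τ < e ∧ τ < (s' : ℝ) - s := by
    obtain ⟨τ, h0, h1⟩ := exists_between (lt_min he (sub_pos.2 hs'))
    exact ⟨τ, h0, lt_min_iff.1 h1⟩
  set φ : Icc a b → ℝ := fun t ↦ max 0 (((t : ℝ) - s - τ) / (s' - s - τ)) with hφ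
  have hd : 0 < (s' : ℝ) - s - τ := by linarith
  refine ⟨fun t ↦ γ.extend (((t : ℝ) - s) / τ) + φ t • (q' - q), ?_, ?_, ?_, ?_⟩
  · have : Continuous φ := by fun_prop
    fun_prop
  · have : φ s = 0 := max_eq_left (div_nonpos_of_nonpos_of_nonneg (by linarith) hd.le)
    simp [this]
  · have : φ s' = 1 := by simp [hφ, div_self hd.ne']
    simp only [this]
    rw [γ.extend_of_one_le ((one_le_div hτ).2 hτs.le)]
    simp
  · rintro t ⟨hst, hts⟩
    have hst' : (s : ℝ) ≤ t := hst
    have hts' : (t : ℝ) ≤ s' := hts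
    rcases le_total ((t : ℝ) - s) τ with h | h
    · have : φ t = 0 := max_eq_left (div_nonpos_of_nonpos_of_nonneg (by linarith) hd.le)
      simp only [this, zero_smul, add_zero]
      have hmem : ((t : ℝ) - s) / τ ∈ unitInterval :=
        ⟨div_nonneg (by linarith) hτ.le, (div_le_one hτ).2 h⟩
      rw [γ.extend_apply hmem]
      refine hball ?_ _ (mem_univ _)
      rw [Subtype.dist_eq, Real.dist_eq, abs_of_nonneg (by linarith)]
      linarith
    · have : φ t = ((t : ℝ) - s - τ) / (s' - s - τ) :=
        max_eq_right (div_nonneg (by linarith) hd.le)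
      simp only [this]
      rw [γ.extend_of_one_le ((one_le_div hτ).2 h)]
      apply hseg t ⟨hst, hts⟩
      rw [segment_eq_image']
      exact ⟨_, ⟨div_nonneg (by linarith) hd.le, (div_le_one hd).2 (by linarith)⟩, rfl⟩

/-- A lower hemicontinuous map `G` on an interval, any two points of whose values can be joined
inside `O t`, where `O` has an open graph, admits a continuous section of `O`. -/
theorem exists_continuous_forall_mem_of_joinedIn (hab : a ≤ b) {G O : Icc a b → Set E}
    (hG : LowerHemicontinuous G) (hO : HasOpenCGraph O) (hne : ∀ t, (G t).Nonempty)
    (hGO : ∀ t, ∀ x ∈ G t, ∀ y ∈ G t, JoinedIn (O t) x y) :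
    ∃ g : Icc a b → E, Continuous g ∧ ∀ t, g t ∈ O t := by
  have hloc : ∀ t₀, ∃ N : Set (Icc a b), IsOpen N ∧ t₀ ∈ N ∧ ∃ q : E, ∃ δ : ℝ,
      ∀ t ∈ N, (G t ∩ ball q δ).Nonempty ∧ ball q δ ⊆ O t := by
    intro t₀
    obtain ⟨q, hq⟩ := hne t₀
    have hqO : q ∈ O t₀ := (hGO t₀ q hq q hq).source_mem
    obtain ⟨U, V, hU, hV, htU, hqV, hUV⟩ := (isOpen_prod_iff.1 hO) t₀ q hqO
    obtain ⟨δ, hδ, hδV⟩ := Metric.isOpen_iff.1 hV q hqV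
    refine ⟨U ∩ {t | (G t ∩ ball q δ).Nonempty},
      hU.inter (lowerHemicontinuous_iff_isOpen_inter_nonempty.1 hG _ isOpen_ball),
      ⟨htU, q, hq, mem_ball_self hδ⟩, q, δ, fun t ht ↦ ⟨ht.2, fun z hz ↦ ?_⟩⟩
    exact hUV (mk_mem_prod ht.1 (hδV hz))
  choose N hNo hmem q δ hN using hloc
  -- On each subinterval one ball meets every `G t` and lies in every `O t`. The section is built
  -- from left to right, with `g (t n) ∈ G (t n)` so that the next bridge can start.
  obtain ⟨t, ht0, htm, ⟨m, hm⟩, hsub⟩ := exists_monotone_Icc_subset_open_cover_Icc hab hNo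
    (fun t _ ↦ mem_iUnion.2 ⟨t, hmem t⟩)
  have key : ∀ n, ∃ g : Icc a b → E, Continuous g ∧ g (t n) ∈ G (t n) ∧
      ∀ u ≤ t n, g u ∈ O u := by
    intro n
    induction n with
    | zero =>
      obtain ⟨p, hp⟩ := hne (t 0)
      refine ⟨fun _ ↦ p, continuous_const, hp, fun u hu ↦ ?_⟩
      have : u = t 0 := le_antisymm hu (Subtype.coe_le_coe.1 (ht0.trans_le u.2.1))
      exact this ▸ (hGO _ p hp p hp).source_mem
    | succ n ih =>
      obtain ⟨g, hg, hgG, hgO⟩ := ih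
      rcases (htm n.le_succ).eq_or_lt with heq | hlt
      · exact ⟨g, hg, heq ▸ hgG, heq ▸ hgO⟩
      obtain ⟨i, hi⟩ := hsub n
      obtain ⟨⟨p, hpG, hpb⟩, -⟩ := hN i (t n) (hi (left_mem_Icc.2 hlt.le))
      obtain ⟨⟨p', hpG', hpb'⟩, -⟩ := hN i (t (n + 1)) (hi (right_mem_Icc.2 hlt.le))
      obtain ⟨h, hh, hh0, hh1, hhO⟩ := exists_continuous_bridge hO hlt (hGO _ _ hgG _ hpG)
        (fun u hu ↦ ((convex_ball _ _).segment_subset hpb hpb').trans (hN i u (hi hu)).2)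
      refine ⟨fun u ↦ if u ≤ t n then g u else h u, ?_, ?_, ?_⟩
      · exact Continuous.if_le hg hh continuous_id continuous_const
          (fun u hu ↦ by rw [show u = t n from hu, hh0])
      · simpa only [if_neg hlt.not_ge, hh1] using hpG'
      · intro u hu
        beta_reduce
        split_ifs with hun
        · exact hgO u hun
        · exact hhO u ⟨(not_le.1 hun).le, hu⟩
  obtain ⟨g, hg, -, hgO⟩ := key m
  refine ⟨g, hg, fun u ↦ hgO u ?_⟩
  exact Subtype.coe_le_coe.1 (u.2.2.trans_eq (hm m le_rfl).symm)

/-- Close points of `S` have an approximate midpoint in `S`. -/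
def HasApproxMidpoints (l : ℝ) (S : Set E) : Prop :=
  ∀ x ∈ S, ∀ y ∈ S, dist x y ≤ l →
    ∃ m ∈ S, dist x m ≤ 3 / 4 * dist x y ∧ dist m y ≤ 3 / 4 * dist x y

/-- Repeated bisection gives a chain in `S` with gaps below `δ`, whose polygon lies in the
thickening. The radius does not depend on `δ`: with `d = dist x y`, the two halves stay within `3d`
and `3d/4 + 3d` of `x`. -/
theorem HasApproxMidpoints.joinedIn {l : ℝ} {S : Set E} (hS : HasApproxMidpoints l S) {δ : ℝ}
    (hδ : 0 < δ) {x y : E} (hx : x ∈ S) (hy : y ∈ S) (hxy : dist x y ≤ l) :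
    JoinedIn (thickening δ S ∩ closedBall x (4 * dist x y)) x y := by
  have key : ∀ n : ℕ, ∀ x ∈ S, ∀ y ∈ S, dist x y ≤ l → (3 / 4 : ℝ) ^ n * dist x y < δ →
      JoinedIn (thickening δ S ∩ closedBall x (4 * dist x y)) x y := by
    intro n
    induction n with
    | zero =>
      intro x hx y hy _ hlt
      rw [pow_zero, one_mul] at hlt
      refine JoinedIn.of_segment_subset fun z hz ↦ ?_
      have hzx : dist z x ≤ dist x y := by
        have := (convex_closedBall x (dist x y)).segment_subset
          (mem_closedBall_self dist_nonneg) (by rw [mem_closedBall, dist_comm]) hz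
        exact this
      refine ⟨mem_thickening_iff.2 ⟨x, hx, hzx.trans_lt hlt⟩, ?_⟩
      rw [mem_closedBall]
      linarith [dist_nonneg (x := x) (y := y)]
    | succ n ih =>
      intro x hx y hy hl hlt
      obtain ⟨m, hm, h1, h2⟩ := hS x hx y hy hl
      have hd := dist_nonneg (x := x) (y := y)
      have hp : (0 : ℝ) ≤ (3 / 4) ^ n := by positivity
      have hstep : ∀ d : ℝ, d ≤ 3 / 4 * dist x y → (3 / 4 : ℝ) ^ n * d < δ := fun d hd ↦ by
        refine (mul_le_mul_of_nonneg_left hd hp).trans_lt ?_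
        rw [← mul_assoc, ← pow_succ]
        exact hlt
      have j1 := ih x hx m hm (by linarith) (hstep _ h1)
      have j2 := ih m hm y hy (by linarith) (hstep _ h2)
      refine (j1.mono ?_).trans (j2.mono ?_)
      · exact inter_subset_inter_right _ (closedBall_subset_closedBall (by linarith))
      · refine inter_subset_inter_right _ (closedBall_subset_closedBall' ?_)
        rw [dist_comm m x]
        linarith
  obtain ⟨n, hn⟩ := exists_pow_lt_of_lt_one (show 0 < δ / (dist x y + 1) by positivity)
    (show (3 / 4 : ℝ) < 1 by norm_num)
  refine key n x hx y hy hxy ?_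
  rw [lt_div_iff₀ (by positivity)] at hn
  refine lt_of_le_of_lt (mul_le_mul_of_nonneg_left ?_ (by positivity)) hn
  linarith

theorem joinedIn_thickening_of_isPreconnected {S : Set E} (hS : IsPreconnected S) {δ : ℝ}
    (hδ : 0 < δ) {x y : E} (hx : x ∈ S) (hy : y ∈ S) : JoinedIn (thickening δ S) x y := by
  have hpre : IsPreconnected (thickening δ S) := by
    rw [← add_ball_zero, ← add_image_prod]
    exact (hS.prod (convex_ball _ _).isPreconnected).image _ continuous_add.continuousOn
  have hsub := self_subset_thickening hδ S
  exact (isOpen_thickening.isConnected_iff_isPathConnected.1 ⟨⟨x, hsub hx⟩, hpre⟩).joinedIn x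
    (hsub hx) y (hsub hy)

theorem exists_continuous_approx_step (hab : a ≤ b) {G : Icc a b → Set E}
    (hG : LowerHemicontinuous G) {l ε : ℝ} (hε : 0 < ε) (hl : 2 * ε ≤ l)
    (hmid : ∀ t, HasApproxMidpoints l (G t)) (f : C(Icc a b, E))
    (hf : ∀ t, f t ∈ thickening ε (G t)) :
    ∃ g : C(Icc a b, E), (∀ t, g t ∈ thickening (ε / 2) (G t)) ∧ dist f g ≤ 9 * ε := by
  have hjoin : ∀ t, ∀ x ∈ G t ∩ ball (f t) ε, ∀ y ∈ G t ∩ ball (f t) ε,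
      JoinedIn (thickening (ε / 2) (G t) ∩ ball (f t) (9 * ε)) x y := by
    rintro t x ⟨hx, hxf⟩ y ⟨hy, hyf⟩
    rw [mem_ball] at hxf hyf
    have hxy : dist x y < 2 * ε := by
      have := dist_triangle_right x y (f t)
      linarith
    -- The path stays within `4 · 2ε` of `x`, hence within `9ε` of `f t`.
    refine ((hmid t).joinedIn (half_pos hε) hx hy (hxy.le.trans hl)).mono ?_
    rintro z ⟨hz, hzx⟩
    refine ⟨hz, ?_⟩
    rw [mem_closedBall] at hzx
    rw [mem_ball]
    have := dist_triangle z x (f t)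
    linarith
  have hne : ∀ t, (G t ∩ ball (f t) ε).Nonempty := fun t ↦ by
    obtain ⟨w, hw, hd⟩ := mem_thickening_iff.1 (hf t)
    exact ⟨w, hw, by rwa [mem_ball, dist_comm]⟩
  obtain ⟨g, hg, hgO⟩ := exists_continuous_forall_mem_of_joinedIn hab
    (hG.inter_hasOpenCGraph (hasOpenCGraph_ball f.continuous ε))
    ((hasOpenCGraph_thickening hG (ε / 2)).inter (hasOpenCGraph_ball f.continuous (9 * ε)))
    hne hjoin
  refine ⟨⟨g, hg⟩, fun t ↦ (hgO t).1, ?_⟩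
  rw [ContinuousMap.dist_le (by positivity)]
  intro t
  rw [dist_comm]
  exact (mem_ball.1 (hgO t).2).le

/-- A one-dimensional Michael selection theorem. -/
theorem exists_continuous_selection [CompleteSpace E] (hab : a ≤ b) {G : Icc a b → Set E}
    (hG : LowerHemicontinuous G) (hne : ∀ t, (G t).Nonempty) (hcl : ∀ t, IsClosed (G t))
    (hconn : ∀ t, IsPreconnected (G t)) {l : ℝ} (hl : 0 < l)
    (hmid : ∀ t, HasApproxMidpoints l (G t)) :
    ∃ g : Icc a b → E, Continuous g ∧ ∀ t, g t ∈ G t := by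
  set ε : ℕ → ℝ := fun n ↦ l / 2 * (1 / 2) ^ n with hεdef
  have hε : ∀ n, 0 < ε n := fun n ↦ by positivity
  have hεl : ∀ n, 2 * ε n ≤ l := fun n ↦ by
    have : (1 / 2 : ℝ) ^ n ≤ 1 := pow_le_one₀ (by norm_num) (by norm_num)
    simp only [hεdef]
    nlinarith
  have hhalf : ∀ n, ε n / 2 = ε (n + 1) := fun n ↦ by simp only [hεdef, pow_succ]; ring
  obtain ⟨f₀, hf₀, hf₀G⟩ := exists_continuous_forall_mem_of_joinedIn hab hG
    (hasOpenCGraph_thickening hG (ε 0)) hne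
    (fun t x hx y hy ↦ joinedIn_thickening_of_isPreconnected (hconn t) (hε 0) hx hy)
  let A : ℕ → Set C(Icc a b, E) := fun n ↦ {f | ∀ t, f t ∈ thickening (ε n) (G t)}
  have hstep : ∀ n, ∀ f : A n, ∃ g : A (n + 1), dist f.1 g.1 ≤ 9 * ε n := by
    rintro n ⟨f, hf⟩
    obtain ⟨g, hg, hfg⟩ := exists_continuous_approx_step hab hG (hε n) (hεl n) hmid f hf
    exact ⟨⟨g, fun t ↦ hhalf n ▸ hg t⟩, hfg⟩
  choose next hnext using hstep
  let F : ∀ n, A n := fun n ↦ Nat.rec ⟨⟨f₀, hf₀⟩, hf₀G⟩ (fun k f ↦ next k f) n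
  have hF : ∀ n, dist (F n).1 (F (n + 1)).1 ≤ 9 * l / 2 * (1 / 2) ^ n := fun n ↦
    (hnext n (F n)).trans_eq (by simp only [hεdef]; ring)
  obtain ⟨g, hg⟩ := cauchySeq_tendsto_of_complete
    (cauchySeq_of_le_geometric (1 / 2) (9 * l / 2) (by norm_num) hF)
  refine ⟨g, g.continuous, fun t ↦ ?_⟩
  have hgt : Tendsto (fun n ↦ (F n).1 t) atTop (𝓝 (g t)) :=
    ((continuous_eval_const t).tendsto g).comp hg
  have hε0 : Tendsto ε atTop (𝓝 0) := by
    simpa only [mul_zero] using (tendsto_pow_atTop_nhds_zero_of_lt_one (r := (1 / 2 : ℝ))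
      (by norm_num) (by norm_num)).const_mul (l / 2)
  choose w hw hdist using fun n ↦ mem_thickening_iff.1 ((F n).2 t)
  refine (hcl t).mem_of_tendsto ((tendsto_iff_of_dist ?_).1 hgt) (Eventually.of_forall hw)
  exact squeeze_zero (fun _ ↦ dist_nonneg) (fun n ↦ (hdist n).le) hε0

end Selection

/-! ### Dense nearest points and approximate midpoints in prox-regular sets -/

section ProxRegular

variable {H : Type*} [NormedAddCommGroup H] [InnerProductSpace ℝ H]

theorem exists_pos_add_sq_lt {d η : ℝ} (hd : 0 ≤ d) (hη : 0 < η) :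
    ∃ δ > 0, δ ≤ 1 ∧ (d + δ) ^ 2 < d ^ 2 + η := by
  refine ⟨min 1 (η / (2 * d + 2)), lt_min one_pos (by positivity), min_le_left _ _, ?_⟩
  have h1 := min_le_left 1 (η / (2 * d + 2))
  have h2 := min_le_right 1 (η / (2 * d + 2))
  have h0 : 0 < min 1 (η / (2 * d + 2)) := lt_min one_pos (by positivity)
  rw [le_div_iff₀ (by positivity)] at h2
  nlinarith

/-- If `y` almost minimizes the distance to `u` on `S`, then almost minimizers of the distance to
a point slightly shifted from `u` towards `y` are close to `y`. -/
theorem mul_norm_sub_sq_le_of_almost_nearest {u y z : H} {t η : ℝ} (ht0 : 0 ≤ t) (ht1 : t ≤ 1)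
    (hη : 0 ≤ η) (hy : ‖y - u‖ ^ 2 ≤ ‖z - u‖ ^ 2 + η)
    (hz : ‖z - (u + t • (y - u))‖ ^ 2 ≤ ‖y - (u + t • (y - u))‖ ^ 2 + η) :
    t * ‖z - y‖ ^ 2 ≤ 2 * η := by
  have e1 : z - (u + t • (y - u)) = (z - u) - t • (y - u) := by abel
  have e2 : y - (u + t • (y - u)) = (y - u) - t • (y - u) := by abel
  have e3 : z - y = (z - u) - (y - u) := by abel
  rw [e1, e2] at hz
  rw [e3]
  generalize z - u = v at *
  generalize y - u = w at *
  rw [norm_sub_sq_real, norm_sub_sq_real, inner_smul_right, inner_smul_right, norm_smul,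
    real_inner_self_eq_norm_sq] at hz
  rw [norm_sub_sq_real]
  -- The expanded `hz` reads `t‖v - w‖² ≤ (1 - t)(‖w‖² - ‖v‖²) + η`.
  nlinarith [mul_nonneg ht0 hη, mul_le_mul_of_nonneg_left hy (sub_nonneg.2 ht1)]

/-- Points at which all `δ`-almost nearest points in `S` are `ε`-close to each other. -/
def almostUniqueNearest {M : Type*} [PseudoMetricSpace M] (S : Set M) (ε : ℝ) : Set M :=
  {u | ∃ δ > 0, ∀ y ∈ S, ∀ z ∈ S, dist u y < infDist u S + δ → dist u z < infDist u S + δ →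
    dist y z < ε}

theorem isOpen_almostUniqueNearest {M : Type*} [PseudoMetricSpace M] (S : Set M) (ε : ℝ) :
    IsOpen (almostUniqueNearest S ε) := by
  rw [Metric.isOpen_iff]
  rintro u ⟨δ, hδ, h⟩
  refine ⟨δ / 3, by positivity, fun v hv ↦ ⟨δ / 3, by positivity, ?_⟩⟩
  rw [mem_ball] at hv
  have h1 := infDist_le_infDist_add_dist (s := S) (x := v) (y := u)
  have key : ∀ y, dist v y < infDist v S + δ / 3 → dist u y < infDist u S + δ := fun y hy ↦ by
    have := dist_triangle u v y
    rw [dist_comm u v] at this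
    linarith
  exact fun y hy z hz h2 h3 ↦ h y hy z hz (key y h2) (key z h3)

theorem dense_almostUniqueNearest {S : Set H} (hS : S.Nonempty) {ε : ℝ} (hε : 0 < ε) :
    Dense (almostUniqueNearest S ε) := by
  rw [Metric.dense_iff]
  intro u r hr
  have hd := infDist_nonneg (s := S) (x := u)
  set t : ℝ := min 1 (r / (2 * (infDist u S + 1))) with ht
  have ht0 : 0 < t := lt_min one_pos (by positivity)
  have ht1 : t ≤ 1 := min_le_left _ _
  have htr : t * (infDist u S + 1) < r := by
    have := min_le_right 1 (r / (2 * (infDist u S + 1)))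
    rw [← ht, le_div_iff₀ (by positivity)] at this
    linarith
  set η : ℝ := t * ε ^ 2 / 16 with hηdef
  have hη : 0 < η := by positivity
  obtain ⟨δ, hδ, hδ1, hδη⟩ := exists_pos_add_sq_lt hd hη
  obtain ⟨y, hy, huy⟩ := (infDist_lt_iff hS).1 (lt_add_of_pos_right (infDist u S) hδ)
  have hnear : ∀ z ∈ S, ‖y - u‖ ^ 2 ≤ ‖z - u‖ ^ 2 + η := fun z hz ↦ by
    have h1 := infDist_le_dist_of_mem (x := u) hz
    rw [dist_comm, dist_eq_norm] at h1 huy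
    nlinarith [norm_nonneg (y - u), pow_le_pow_left₀ (norm_nonneg _) huy.le 2,
      pow_le_pow_left₀ hd h1 2]
  set v := u + t • (y - u) with hv
  obtain ⟨δ', hδ', -, hδη'⟩ := exists_pos_add_sq_lt (infDist_nonneg (s := S) (x := v)) hη
  refine ⟨v, ?_, δ', hδ', ?_⟩
  · rw [mem_ball, dist_eq_norm, hv, add_sub_cancel_left, norm_smul, Real.norm_of_nonneg ht0.le]
    rw [dist_comm, dist_eq_norm] at huy
    refine lt_of_le_of_lt (mul_le_mul_of_nonneg_left ?_ ht0.le) htr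
    linarith
  · have hclose : ∀ z ∈ S, dist v z < infDist v S + δ' → dist z y < ε / 2 := fun z hz hvz ↦ by
      have h1 := infDist_le_dist_of_mem (x := v) hy
      rw [dist_comm, dist_eq_norm] at h1 hvz
      have h2 : t * ‖z - y‖ ^ 2 ≤ 2 * η := by
        refine mul_norm_sub_sq_le_of_almost_nearest ht0.le ht1 hη.le (hnear z hz) ?_
        nlinarith [pow_le_pow_left₀ (norm_nonneg _) hvz.le 2,
          pow_le_pow_left₀ infDist_nonneg h1 2]
      rw [dist_eq_norm]
      refine lt_of_pow_lt_pow_left₀ 2 (by positivity) (lt_of_mul_lt_mul_left ?_ ht0.le)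
      have : 0 < t * ε ^ 2 := by positivity
      calc t * ‖z - y‖ ^ 2 ≤ 2 * η := h2
        _ < t * (ε / 2) ^ 2 := by rw [hηdef]; linarith
    intro z hz w hw h1 h2
    have := dist_triangle_right z w y
    linarith [hclose z hz h1, hclose w hw h2]

/-- In a Hilbert space, the points having a nearest point in a closed set are dense. -/
theorem exists_near_exists_nearest [CompleteSpace H] {S : Set H} (hne : S.Nonempty)
    (hcl : IsClosed S) (u : H) {ε : ℝ} (hε : 0 < ε) :
    ∃ c, dist c u < ε ∧ ∃ p ∈ S, ∀ z ∈ S, dist c p ≤ dist c z := by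
  -- Baire category: at a point of this intersection every minimizing sequence is Cauchy.
  have hdense : Dense (⋂ n : ℕ, almostUniqueNearest S (1 / (n + 1 : ℝ))) :=
    dense_iInter_of_isOpen (fun n ↦ isOpen_almostUniqueNearest S _)
      (fun n ↦ dense_almostUniqueNearest hne (by positivity))
  obtain ⟨c, hcu, hc⟩ := Metric.dense_iff.1 hdense u ε hε
  rw [mem_iInter] at hc
  refine ⟨c, hcu, ?_⟩
  have hex : ∀ n : ℕ, ∃ y ∈ S, dist c y < infDist c S + 1 / (n + 1 : ℝ) := fun n ↦
    (infDist_lt_iff hne).1 (lt_add_of_pos_right _ (by positivity))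
  choose y hyS hy using hex
  have hcauchy : CauchySeq y := by
    refine Metric.cauchySeq_iff.2 fun e he ↦ ?_
    obtain ⟨n, hn⟩ := exists_nat_one_div_lt he
    obtain ⟨δ, hδ, hδc⟩ := hc n
    obtain ⟨N, hN⟩ := exists_nat_one_div_lt hδ
    have hclose : ∀ k ≥ N, dist c (y k) < infDist c S + δ := fun k hk ↦
      (hy k).trans_le (add_le_add_right ((Nat.one_div_le_one_div hk).trans hN.le) _)
    exact ⟨N, fun i hi j hj ↦ (hδc _ (hyS i) _ (hyS j) (hclose i hi) (hclose j hj)).trans hn⟩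
  obtain ⟨p, hp⟩ := cauchySeq_tendsto_of_complete hcauchy
  refine ⟨p, hcl.mem_of_tendsto hp (Eventually.of_forall hyS), fun z hz ↦ ?_⟩
  have hle : dist c p ≤ infDist c S + 0 :=
    le_of_tendsto_of_tendsto' (tendsto_const_nhds.dist hp)
      (tendsto_const_nhds.add tendsto_one_div_add_atTop_nhds_zero_nat) fun n ↦ (hy n).le
  rw [add_zero] at hle
  exact hle.trans (infDist_le_dist_of_mem hz)

theorem sub_mem_proximalNormalCone {S : Set H} {c p : H} (hp : p ∈ S)
    (h : ∀ z ∈ S, dist c p ≤ dist c z) : c - p ∈ proximalNormalCone S p := by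
  refine mem_proximalNormalCone_iff.2 ⟨hp, 1 / 2, by norm_num, 1, one_pos, fun z hz _ ↦ ?_⟩
  have h1 := h z hz
  rw [dist_eq_norm, dist_eq_norm, ← sub_sub_sub_cancel_right c z p] at h1
  have h2 := pow_le_pow_left₀ (norm_nonneg _) h1 2
  rw [norm_sub_sq_real (c - p)] at h2
  linarith

/-- The midpoint `u` may have no nearest point in `S`, but some `c` close to it has one, `p`. Then
`c - p` is a proximal normal, and adding the regularity inequalities towards `x` and `y` makes `dist
c p` small compared with `L`. -/
theorem IsUniformlyProxRegular.hasApproxMidpoints [CompleteSpace H] {ρ : ℝ≥0∞} {S : Set H}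
    (hS : IsUniformlyProxRegular ρ S) {l : ℝ} (hl : ((2 * ρ)⁻¹).toReal * l ≤ 1 / 4) :
    HasApproxMidpoints l S := by
  obtain ⟨hne, hcl, hreg⟩ := hS
  set κ := ((2 * ρ)⁻¹).toReal
  have hκ : 0 ≤ κ := ENNReal.toReal_nonneg
  intro x hx y hy hxy
  rcases eq_or_ne x y with rfl | hxne
  · exact ⟨x, hx, by simp, by simp⟩
  set L := dist x y with hL
  have hLpos : 0 < L := dist_pos.2 hxne
  set u := midpoint ℝ x y
  have hux : dist x u = L / 2 := by
    rw [dist_left_midpoint, Real.norm_of_nonneg (by norm_num)]; ring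
  have huy : dist u y = L / 2 := by
    rw [dist_midpoint_right, Real.norm_of_nonneg (by norm_num)]; ring
  obtain ⟨c, hcu, p, hp, hmin⟩ := exists_near_exists_nearest hne hcl u
    (show 0 < L / 32 by positivity)
  have hnormal := sub_mem_proximalNormalCone hp hmin
  have hcp : dist c p ≤ L / 2 + L / 32 := by
    have h1 := hmin x hx
    have h2 := dist_triangle c u x
    rw [dist_comm u x] at h2
    linarith
  have hup : dist u p ≤ L / 2 + L / 16 := by
    have := dist_triangle u c p
    rw [dist_comm u c] at this
    linarith
  have hpar : ‖x - p‖ ^ 2 + ‖y - p‖ ^ 2 = 2 * ‖u - p‖ ^ 2 + L ^ 2 / 2 := by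
    have hpl := parallelogram_law_with_norm ℝ (x - p) (y - p)
    have e1 : x - p + (y - p) = (2 : ℝ) • (u - p) := by
      simp only [u, midpoint_eq_smul_add, smul_sub, smul_smul]
      norm_num [two_smul]
      abel
    rw [e1, sub_sub_sub_cancel_right, norm_smul, ← dist_eq_norm x y, ← hL] at hpl
    norm_num at hpl
    nlinarith
  have hinner : inner ℝ (c - p) (x - p) + inner ℝ (c - p) (y - p) =
      2 * ‖c - p‖ ^ 2 + 2 * inner ℝ (c - p) (u - c) := by
    rw [← real_inner_self_eq_norm_sq, ← mul_add, ← inner_add_right, ← inner_add_right]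
    have e1 : x - p + (y - p) = (2 : ℝ) • (c - p + (u - c)) := by
      simp only [u, midpoint_eq_smul_add, smul_sub, smul_add, smul_smul]
      norm_num [two_smul]
      abel
    rw [e1, inner_smul_right]
  have hbound : dist c p ≤ L / 32 + κ * (dist u p ^ 2 + L ^ 2 / 4) := by
    rcases (dist_nonneg (x := c) (y := p)).eq_or_lt with h0 | hpos
    · rw [← h0]
      positivity
    refine le_of_mul_le_mul_left ?_ hpos
    have h1 := hreg p hp _ hnormal x hx
    have h2 := hreg p hp _ hnormal y hy
    have h3 := neg_le_of_abs_le (abs_real_inner_le_norm (c - p) (u - c))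
    rw [dist_comm, dist_eq_norm] at hcu
    simp only [dist_eq_norm] at hpos ⊢
    have h4 := mul_le_mul_of_nonneg_left hcu.le hpos.le
    have h5 : ‖c - p‖ * κ * (‖x - p‖ ^ 2 + ‖y - p‖ ^ 2) =
      ‖c - p‖ * κ * (2 * ‖u - p‖ ^ 2 + L ^ 2 / 2) := by rw [hpar]
    nlinarith
  have hκL : κ * L ≤ 1 / 4 := (mul_le_mul_of_nonneg_left hxy hκ).trans hl
  -- The crude bound `9L/16` is fed back into `hbound`: `L/32 + L/32 + (145/1024) L < L/4`.
  have hup4 : dist u p ≤ L / 4 := by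
    have h1 := dist_triangle u c p
    rw [dist_comm u c] at h1
    have h2 := pow_le_pow_left₀ dist_nonneg hup 2
    have h3 : κ * (dist u p ^ 2 + L ^ 2 / 4) ≤ κ * (((L / 2 + L / 16) ^ 2) + L ^ 2 / 4) :=
      mul_le_mul_of_nonneg_left (by linarith) hκ
    have h4 := mul_le_mul_of_nonneg_right hκL hLpos.le
    nlinarith
  refine ⟨p, hp, ?_, ?_⟩
  · linarith [dist_triangle x u p]
  · have := dist_triangle p u y
    rw [dist_comm p u] at this
    linarith

end ProxRegular

/-! ### From selection to extension -/

section Extension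

open Classical in
/-- The set-valued map which equals `{y t}` on `K` and `G t` off `K`. -/
noncomputable def prescribeOn {X E : Type*} (G : X → Set E) {K : Set X} (y : K → E) (t : X) :
    Set E :=
  if h : t ∈ K then {y ⟨t, h⟩} else G t

variable {X E : Type*} {G : X → Set E} {K : Set X} {y : K → E}

theorem prescribeOn_of_mem {t : X} (h : t ∈ K) : prescribeOn G y t = {y ⟨t, h⟩} := dif_pos h

theorem prescribeOn_of_notMem {t : X} (h : t ∉ K) : prescribeOn G y t = G t := dif_neg h

theorem prescribeOn_subset (hy : ∀ t : K, y t ∈ G t) (t : X) : prescribeOn G y t ⊆ G t := by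
  by_cases h : t ∈ K
  · rw [prescribeOn_of_mem h, singleton_subset_iff]
    exact hy ⟨t, h⟩
  · rw [prescribeOn_of_notMem h]

/-- Near a point of `K`, continuity of `y` handles times in `K` and lower hemicontinuity of `G` the
others; off `K`, closedness leaves only `G`. -/
theorem lowerHemicontinuous_prescribeOn [TopologicalSpace X] [TopologicalSpace E]
    (hG : LowerHemicontinuous G) (hK : IsClosed K) (hy : Continuous y)
    (hyG : ∀ t : K, y t ∈ G t) : LowerHemicontinuous (prescribeOn G y) := by
  refine lowerHemicontinuous_iff.2 fun t ↦ lowerHemicontinuousAt_iff.2 fun U hU hne ↦ ?_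
  have hGU := lowerHemicontinuousAt_iff.1 (hG t) U hU
    (hne.mono (inter_subset_inter_left _ (prescribeOn_subset hyG t)))
  by_cases h : t ∈ K
  · have hyU : y ⟨t, h⟩ ∈ U := by simpa [prescribeOn_of_mem h] using hne
    have hev : ∀ᶠ s : K in 𝓝 ⟨t, h⟩, y s ∈ U := hy.continuousAt (hU.mem_nhds hyU)
    rw [nhds_subtype, eventually_comap] at hev
    filter_upwards [hGU, hev] with s hs hs'
    by_cases hsK : s ∈ K
    · rw [prescribeOn_of_mem hsK]
      exact ⟨_, rfl, hs' ⟨s, hsK⟩ rfl⟩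
    · rwa [prescribeOn_of_notMem hsK]
  · filter_upwards [hGU, hK.isOpen_compl.mem_nhds h] with s hs hsK
    rwa [prescribeOn_of_notMem hsK]

theorem hasApproxMidpoints_singleton [NormedAddCommGroup E] [NormedSpace ℝ E] (l : ℝ) (x : E) :
    HasApproxMidpoints l {x} := by
  rintro y rfl z rfl -
  exact ⟨z, rfl, by simp, by simp⟩

theorem hasApproxMidpoints_of_convex [NormedAddCommGroup E] [NormedSpace ℝ E] {S : Set E}
    (hS : Convex ℝ S) (l : ℝ) : HasApproxMidpoints l S := by
  intro x hx y hy _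
  refine ⟨midpoint ℝ x y, hS.midpoint_mem hx hy, ?_, ?_⟩
  · rw [dist_left_midpoint]
    norm_num
    linarith [dist_nonneg (x := x) (y := y)]
  · rw [dist_midpoint_right]
    norm_num
    linarith [dist_nonneg (x := x) (y := y)]

theorem exists_continuous_selection_extension [NormedAddCommGroup E] [NormedSpace ℝ E]
    [CompleteSpace E] {a b : ℝ} (hab : a ≤ b) {G : Icc a b → Set E} (hG : LowerHemicontinuous G)
    (hne : ∀ t, (G t).Nonempty) (hcl : ∀ t, IsClosed (G t)) (hconn : ∀ t, IsPreconnected (G t))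
    {l : ℝ} (hl : 0 < l) (hmid : ∀ t, HasApproxMidpoints l (G t)) {K : Set (Icc a b)}
    (hK : IsClosed K) {y : K → E} (hy : Continuous y) (hyG : ∀ t : K, y t ∈ G t) :
    ∃ g : Icc a b → E, Continuous g ∧ (∀ t, g t ∈ G t) ∧ ∀ t : K, g t = y t := by
  have hval : ∀ t, (∃ x, prescribeOn G y t = {x}) ∨ prescribeOn G y t = G t := fun t ↦ by
    by_cases h : t ∈ K
    · exact .inl ⟨_, prescribeOn_of_mem h⟩
    · exact .inr (prescribeOn_of_notMem h)
  obtain ⟨g, hg, hgG⟩ := exists_continuous_selection hab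
    (lowerHemicontinuous_prescribeOn hG hK hy hyG)
    (fun t ↦ by rcases hval t with ⟨x, h⟩ | h <;> rw [h]; exacts [singleton_nonempty x, hne t])
    (fun t ↦ by rcases hval t with ⟨x, h⟩ | h <;> rw [h]; exacts [isClosed_singleton, hcl t])
    (fun t ↦ by rcases hval t with ⟨x, h⟩ | h <;> rw [h]; exacts [isPreconnected_singleton, hconn t])
    hl
    (fun t ↦ by
      rcases hval t with ⟨x, h⟩ | h <;> rw [h]
      exacts [hasApproxMidpoints_singleton l x, hmid t])
  refine ⟨g, hg, fun t ↦ prescribeOn_subset hyG t (hgG t), fun t ↦ ?_⟩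
  have := hgG t
  rwa [prescribeOn_of_mem t.2] at this

theorem lowerHemicontinuous_closure [TopologicalSpace X] [TopologicalSpace E]
    (hG : LowerHemicontinuous G) : LowerHemicontinuous fun t ↦ closure (G t) := by
  rw [lowerHemicontinuous_iff_isOpen_inter_nonempty] at hG ⊢
  intro U hU
  simpa only [closure_inter_open_nonempty_iff hU] using hG U hU

end Extension

/-! ### The two cases of the theorem -/

section BoundedExtension

variable {H : Type*} [NormedAddCommGroup H] [InnerProductSpace ℝ H] [CompleteSpace H] {T : ℝ}
  {C : Icc (0 : ℝ) T → Set H}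

theorem boundedSelectionExtension_of_proxRegularValues (hT : 0 ≤ T) (hC : LowerHemicontinuous C)
    {ρ : ℝ≥0∞} (hprox : ProxRegularValues ρ C) {r : ℝ} (hr : 0 < r)
    (hball : (⋃ t, C t) ⊆ closedBall (0 : H) r) : BoundedSelectionExtension C := by
  intro x _ _ η _
  refine ⟨r, hr, fun K hK y hy hyC _ ↦ ?_⟩
  set κ := ((2 * ρ)⁻¹).toReal with hκdef
  have hκ : 0 ≤ κ := ENNReal.toReal_nonneg
  -- The `+ 1` keeps the scale finite when `κ = 0`, that is for `ρ = +∞`.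
  have hl : κ * (1 / (4 * (κ + 1))) ≤ 1 / 4 := by
    rw [mul_one_div, div_le_div_iff₀ (by positivity) (by norm_num)]
    linarith
  obtain ⟨g, hg, hgC, hgK⟩ := exists_continuous_selection_extension hT hC
    (fun t ↦ (hprox t).1) (fun t ↦ (hprox t).2.1) (fun t ↦ (hprox t).2.2.1.isPreconnected)
    (by positivity) (fun t ↦ (hprox t).2.2.2.hasApproxMidpoints hl) hK.isClosed hy hyC
  exact ⟨g, hg, hgC, hgK, fun t ↦ mem_closedBall_zero_iff.1 (hball (mem_iUnion_of_mem t (hgC t)))⟩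

theorem boundedSelectionExtension_of_convex (hT : 0 ≤ T) (hC : LowerHemicontinuous C)
    (hval : ∀ t, (C t).Nonempty ∧ IsClosed (C t) ∧ Convex ℝ (C t)) :
    BoundedSelectionExtension C := by
  intro x hx _ η hη
  obtain ⟨z, hz, hzC⟩ := exists_continuous_selection hT hC (fun t ↦ (hval t).1)
    (fun t ↦ (hval t).2.1) (fun t ↦ (hval t).2.2.isPreconnected) one_pos
    (fun t ↦ hasApproxMidpoints_of_convex (hval t).2.2 1)
  obtain ⟨A, hA, hxA⟩ := hx.exists_pos_norm_le
  obtain ⟨B, hB, hzB⟩ := (isCompact_range hz).isBounded.exists_pos_norm_le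
  have hxA' : ∀ t, ‖x t‖ ≤ A := fun t ↦ hxA _ (mem_range_self t)
  have hzB' : ∀ t, ‖z t‖ ≤ B := fun t ↦ hzB _ (mem_range_self t)
  -- `‖y t - z t‖ ≤ η + A + B`; the `+ 1` puts `y t` in the open ball. Openness preserves lower
  -- hemicontinuity of the intersection, and the closure makes its values closed.
  set c := η + A + B + 1 with hc
  refine ⟨c + B, by positivity, fun K hK y hy hyC hyx ↦ ?_⟩
  have hyball : ∀ t : K, y t ∈ ball (z t) c := fun t ↦ by
    rw [mem_ball, dist_eq_norm]
    have h1 : y t - z t = (y t - x t) + x t - z t := by abel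
    rw [h1]
    have h2 := norm_sub_le (y t - x t + x t) (z t)
    have h3 := norm_add_le (y t - x t) (x t)
    linarith [hyx t, hxA' t, hzB' t]
  have hconv : ∀ t, Convex ℝ (closure (C t ∩ ball (z t) c)) := fun t ↦
    ((hval t).2.2.inter (convex_ball _ _)).closure
  obtain ⟨g, hg, hgG, hgK⟩ := exists_continuous_selection_extension hT
    (lowerHemicontinuous_closure (hC.inter_hasOpenCGraph (hasOpenCGraph_ball hz c)))
    (fun t ↦ ⟨z t, subset_closure ⟨hzC t, mem_ball_self (by positivity)⟩⟩)
    (fun t ↦ isClosed_closure) (fun t ↦ (hconv t).isPreconnected) one_pos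
    (fun t ↦ hasApproxMidpoints_of_convex (hconv t) 1) hK.isClosed hy
    (fun t ↦ subset_closure ⟨hyC t, hyball t⟩)
  refine ⟨g, hg, fun t ↦ ?_, hgK, fun t ↦ ?_⟩
  · exact closure_minimal inter_subset_left (hval t).2.1 (hgG t)
  · have h1 : g t ∈ closedBall (z t) c :=
      closure_minimal (inter_subset_right.trans ball_subset_closedBall) isClosed_closedBall (hgG t)
    rw [mem_closedBall, dist_eq_norm] at h1
    linarith [norm_le_norm_sub_add (g t) (z t), hzB' t]

end BoundedExtension

end MovingSet


theorem proposition3p1 {H : Type*} [NormedAddCommGroup H] [InnerProductSpace ℝ H]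
    [CompleteSpace H] (T : ℝ) (hT : 0 < T) (C : Set.Icc (0 : ℝ) T → Set H)
    (hC : LowerHemicontinuous C) :
    (∀ ρ : ENNReal, 0 < ρ → MovingSet.ProxRegularValues ρ C →
      (∃ r : ℝ, 0 < r ∧ (⋃ t, C t) ⊆ Metric.closedBall (0 : H) r) →
        MovingSet.BoundedSelectionExtension C) ∧
    ((∀ t, (C t).Nonempty ∧ IsClosed (C t) ∧ Convex ℝ (C t)) →
      MovingSet.BoundedSelectionExtension C) :=
  ⟨fun _ _ hprox ⟨_, hr, hball⟩ ↦
    MovingSet.boundedSelectionExtension_of_proxRegularValues hT.le hC hprox hr hball,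
    MovingSet.boundedSelectionExtension_of_convex hT.le hC⟩
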